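/- Let $p$ be an odd prime, $F$ a field of characteristic $p$, and $L=\bigoplus_{i\ge 1}L_i$ an infinite-dimensional graded Lie algebra over $F$ of maximal class, that is, $\dim L_1=2$, $\dim L_i\le 1$ for $i\ge 2$, and $L$ is generated by $L_1$. For $i\ge 2$ let $C_i=\{u\in L_1 : [L_i,u]=0\}$ be its two-step centralizers. Suppose that not all $C_i$ equal $C_2$, and that the smallest $n\ge 2$ with $C_n\ne C_2$ is $n=2q$ (by a known theorem $n$ always has this form, with $q$ a power of $p$; $q$ is called the parameter of $L$). The first constituent is $C_2,\dots,C_{2q}$, by convention of length $2q$; every other constituent is a block $C_{i+1},\dots,C_{i+\ell}$ (of length $\ell\ge 1$), with $i \ge 2$, $C_i\ne C_2$, $C_{i+\ell}\ne C_2$ and $C_{i+1}=\dots=C_{i+\ell-1}=C_2$. Let $m\ge 0$ be an integer. Suppose that the sequence of constituent lengths of $L$ begins with $$2q,\ \underbrace{q,\dots,q}_{m},\ 2q,$$ and that the corresponding initial segment $C_2,C_3,\dots,C_{(m+4)q}$ of the sequence of two-step centralizers involves only the first two two-step centralizers $C_2$ and $C_{2q}$. Then $m=2r-3$ for some power $r=p^k$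 of $p$. -/

import Mathlib

namespace MaxClass

variable {F L : Type*} [Field F] [LieRing L] [LieAlgebra F L]

/-- A Lie algebra `L` with a grading `𝒜` is of maximal class: `L = ⨁_{i ≥ 1} 𝒜 i` (that is,
`𝒜 0 = 0`), `dim 𝒜 1 = 2`, `dim 𝒜 i ≤ 1` for `i ≥ 2`, and `L` is generated as a Lie algebra
by `𝒜 1`. -/
structure IsMaximalClass (𝒜 : ℕ → Submodule F L) [GradedLieAlgebra 𝒜] : Prop where
  zero_eq_bot : 𝒜 0 = ⊥
  rank_one : Module.rank F (𝒜 1) = 2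
  rank_le_one : ∀ i : ℕ, 2 ≤ i → Module.rank F (𝒜 i) ≤ 1
  generated : LieSubalgebra.lieSpan F L (𝒜 1 : Set L) = ⊤

/-- The two-step centralizer `C_i = C_{L_1}(L_i)`, used for `i ≥ 2`. -/
def twoStepCentralizer (𝒜 : ℕ → Submodule F L) (i : ℕ) : Submodule F L where
  carrier := {u | u ∈ 𝒜 1 ∧ ∀ v ∈ 𝒜 i, ⁅v, u⁆ = 0}
  zero_mem' := ⟨(𝒜 1).zero_mem, fun v _ => lie_zero v⟩
  add_mem' := fun ha hb => ⟨(𝒜 1).add_mem ha.1 hb.1, fun v hv => by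
    rw [lie_add, ha.2 v hv, hb.2 v hv, add_zero]⟩
  smul_mem' := fun c _ ha => ⟨(𝒜 1).smul_mem c ha.1, fun v hv => by
    rw [lie_smul, ha.2 v hv, smul_zero]⟩

/-- `C_2, …, C_n` is the first constituent, where `C_n` is the first occurrence of the second
two-step centralizer; by convention its length is `n`. -/
def IsFirstConstituent (𝒜 : ℕ → Submodule F L) (n : ℕ) : Prop :=
  2 ≤ n ∧ twoStepCentralizer 𝒜 n ≠ twoStepCentralizer 𝒜 2 ∧
    ∀ i, 2 ≤ i → i < n → twoStepCentralizer 𝒜 i = twoStepCentralizer 𝒜 2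

/-- `C_{i+1}, …, C_{i+n}` is a constituent (of length `n`) other than the first one. -/
def IsConstituent (𝒜 : ℕ → Submodule F L) (i n : ℕ) : Prop :=
  2 ≤ i ∧ 1 ≤ n ∧ twoStepCentralizer 𝒜 i ≠ twoStepCentralizer 𝒜 2 ∧
    twoStepCentralizer 𝒜 (i + n) ≠ twoStepCentralizer 𝒜 2 ∧
    ∀ j, 1 ≤ j → j < n → twoStepCentralizer 𝒜 (i + j) = twoStepCentralizer 𝒜 2

/-- The consecutive constituents that start right after `C_i` have lengths given by the list. -/
def ConstituentsFrom (𝒜 : ℕ → Submodule F L) : ℕ → List ℕ → Prop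
  | _, [] => True
  | i, n :: ns => IsConstituent 𝒜 i n ∧ ConstituentsFrom 𝒜 (i + n) ns

/-- The sequence of constituent lengths begins with the nonempty list `n :: ns`; the corresponding
initial segment of the sequence of two-step centralizers is `C_2, …, C_s` with
`s = (n :: ns).sum`. -/
def InitialConstituentLengths (𝒜 : ℕ → Submodule F L) : List ℕ → Prop
  | [] => True
  | n :: ns => IsFirstConstituent 𝒜 n ∧ ConstituentsFrom 𝒜 n ns

/-- `q` is the parameter: the second two-step centralizer first occurs in weight `2 q`. -/
def IsParameter (𝒜 : ℕ → Submodule F L) (q : ℕ) : Prop :=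
  IsFirstConstituent 𝒜 (2 * q)

/-- All of `C_2, …, C_s` are one of the first two two-step centralizers `C_2` and `C_{2q}`, where
`q` is the parameter. -/
def InvolvesOnlyFirstTwo (𝒜 : ℕ → Submodule F L) (q s : ℕ) : Prop :=
  ∀ i, 2 ≤ i → i ≤ s →
    twoStepCentralizer 𝒜 i = twoStepCentralizer 𝒜 2 ∨
      twoStepCentralizer 𝒜 i = twoStepCentralizer 𝒜 (2 * q)

end MaxClass

/-!
Let `D` be a derivation of a Lie algebra over a field of characteristic `p` and let `d` be the only
exponent with `⁅D^d y, y⁆ ≠ 0`. Expanding `⁅D^i y, D^j y⁆` by the Leibniz rule, skew symmetry and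
the Jacobi identity with `y` become congruences modulo `p` on the binomial coefficients around
row `d + 1`. If moreover no `D^k ⁅D^d y, y⁆` is killed by both `D` and `y` without being zero,
these congruences force `d + 1 = 2 p^s`.

Choose `x` in `C_{2q}` and `y` in `C_2`. For `D = ad x` and this `y` one has `d + 1 = 2q`, so `q` is
a power of `p` and `E = (ad x)^q` is again a derivation. Together with `v = (ad x)^(q-1) y` it
generates the deflation of `L`, in which the components of `L` of weight divisible by `q` survive;
similar congruences show that constituents of `L` have length at least `q`, so that no nonzero
homogeneous element of weight at least `2` is killed by both `E` and `v`. Now `E` kills the element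
`z_j = (ad v)^j E v` of weight `(j + 2)q` for `j ≤ m`, because `C_{(j+2)q} = C_{2q}` contains `x`,
but it does not kill `z_{m+1}`, which lies in the middle of the last constituent, of length `2q`.
Thus the criterion applies in `Der L` to `D = ad (ad v)`, `E` in the place of `y` and `d = m + 2`,
and gives `m + 3 = 2 p^s`.
-/

namespace MaxClass

section Binomial

lemma choose_prime_pow_modEq {p : ℕ} (hp : p.Prime) (n a : ℕ) :
    n.choose (p ^ a) ≡ n / p ^ a [MOD p] := by
  have := Fact.mk hp
  induction a generalizing n with
  | zero => simpa using Nat.ModEq.refl n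
  | succ a ih =>
    have h := Choose.choose_modEq_choose_mod_mul_choose_div_nat (p := p) (n := n) (k := p ^ (a + 1))
    rw [pow_succ', Nat.mul_mod_right, Nat.mul_div_cancel_left _ hp.pos, Nat.choose_zero_right,
      one_mul] at h
    rw [pow_succ', ← Nat.div_div_eq_div_mul]
    exact h.trans (ih (n / p))

lemma exists_prime_pow_le_not_dvd_choose {p : ℕ} (hp : p.Prime) (k : ℕ) :
    ∃ a, p ^ a ≤ k + 1 ∧ ¬ p ∣ (k + p ^ a).choose (p ^ a) := by
  obtain ⟨a, c, hc, hk⟩ := Nat.exists_eq_pow_mul_and_not_dvd k.succ_ne_zero p hp.ne_one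
  have ha : 0 < p ^ a := pow_pos hp.pos a
  refine ⟨a, Nat.le_of_dvd k.succ_pos ⟨c, hk⟩, fun h => hc ?_⟩
  have hdiv : (k + p ^ a) / p ^ a = c := by
    rw [show k + p ^ a = p ^ a - 1 + p ^ a * c by omega, Nat.add_mul_div_left _ _ ha,
      Nat.div_eq_of_lt (by omega), zero_add]
  rwa [(choose_prime_pow_modEq hp _ a).dvd_iff (dvd_refl p), hdiv] at h

lemma eq_prime_pow_or_eq_two_mul_prime_pow {p : ℕ} (hp : p.Prime) {n k : ℕ} (hn : n ≠ 0)
    (hrow : ∀ j, 0 < j → j ≤ k → p ∣ n.choose j)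
    (hdiag : ∀ t, 0 < t → k + 1 + t < n → p ∣ (k + t).choose t) :
    ∃ s, n = p ^ s ∨ n = 2 * p ^ s := by
  obtain ⟨s, c, hc, rfl⟩ := Nat.exists_eq_pow_mul_and_not_dvd hn p hp.ne_one
  have hs : 0 < p ^ s := pow_pos hp.pos s
  have hks : k + 1 ≤ p ^ s := by
    by_contra! hlt
    have h := hrow _ hs (by omega)
    rw [(choose_prime_pow_modEq hp _ s).dvd_iff (dvd_refl p), Nat.mul_div_cancel_left _ hs] at h
    exact hc h
  obtain ⟨a, hak, ha⟩ := exists_prime_pow_le_not_dvd_choose hp k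
  have hna : p ^ s * c ≤ k + 1 + p ^ a := by
    by_contra! hlt
    exact ha (hdiag _ (pow_pos hp.pos a) hlt)
  have hc2 : c ≤ 2 := Nat.le_of_mul_le_mul_left (by omega) hs
  have hc0 : c ≠ 0 := by rintro rfl; exact hc (dvd_zero p)
  obtain rfl | rfl : c = 1 ∨ c = 2 := by omega
  · exact ⟨s, .inl (mul_one _)⟩
  · exact ⟨s, .inr (mul_comm _ _)⟩

lemma neg_one_pow_mul_choose_prime_pow_sub_one {R : Type*} [Ring R] {p : ℕ} [CharP R p]
    (hp : p.Prime) {s k : ℕ} (hk : k < p ^ s) :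
    (-1 : R) ^ k * ((p ^ s - 1).choose k : R) = 1 := by
  have halt := Int.alternating_sum_range_choose_eq_choose (n := p ^ s - 1) (m := k)
  rw [Nat.sub_add_cancel (pow_pos hp.pos s)] at halt
  have hcast := congrArg (Int.cast : ℤ → R) halt
  push_cast at hcast
  rw [← hcast, Finset.sum_range_succ', Finset.sum_eq_zero fun j hj => ?_]
  · simp
  · rw [Finset.mem_range] at hj
    rw [(CharP.cast_eq_zero_iff R p _).2 (hp.dvd_choose_pow j.succ_ne_zero (by omega)), mul_zero]

end Binomial

section Derivation

open Finset.HasAntidiagonal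

variable {R L : Type*} [CommRing R] [LieRing L] [LieAlgebra R L] (D : LieDerivation R L L)

lemma lie_iterate (u v : L) (k : ℕ) :
    ⁅u, D^[k] v⁆ = ∑ ij ∈ antidiagonal k,
      k.choose ij.1 • ((-1 : R) ^ ij.1 • D^[ij.2] ⁅D^[ij.1] u, v⁆) := by
  induction k generalizing u with
  | zero => simp
  | succ k ih =>
    have hleibniz : ⁅u, D^[k + 1] v⁆ = D ⁅u, D^[k] v⁆ - ⁅D u, D^[k] v⁆ := by
      rw [LieDerivation.apply_lie_eq_add, Function.iterate_succ_apply', add_sub_cancel_right]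
    rw [Finset.sum_antidiagonal_choose_succ_nsmul
      (fun i j => (-1 : R) ^ i • D^[j] ⁅D^[i] u, v⁆), hleibniz, ih, ih (D u), sub_eq_add_neg,
      map_sum, ← Finset.sum_neg_distrib]
    congr 1
    · exact Finset.sum_congr rfl fun ij _ => by
        rw [map_nsmul, map_smul, Function.iterate_succ_apply']
    · refine Finset.sum_congr rfl fun ij hij => ?_
      rw [← Nat.choose_symm_of_eq_add (mem_antidiagonal.1 hij).symm,
        Function.iterate_succ_apply, pow_succ, mul_neg_one, neg_smul, smul_neg]

variable {D}

lemma lie_iterate_eq_zero {u v : L} {k : ℕ} (h : ∀ s ≤ k, ⁅D^[s] u, v⁆ = 0) :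
    ⁅u, D^[k] v⁆ = 0 := by
  rw [lie_iterate]
  refine Finset.sum_eq_zero fun ij hij => ?_
  rw [h _ (antidiagonal.fst_le hij), iterate_map_zero, smul_zero, smul_zero]

lemma lie_iterate_eq_single {u v : L} {k t : ℕ}
    (h : ∀ s ≤ k + t, s ≠ t → ⁅D^[s] u, v⁆ = 0) :
    ⁅u, D^[k + t] v⁆ = ((-1 : R) ^ t * ((k + t).choose t : R)) • D^[k] ⁅D^[t] u, v⁆ := by
  rw [lie_iterate, Finset.sum_eq_single (t, k), mul_comm, mul_smul, Nat.cast_smul_eq_nsmul]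
  · rintro ⟨i, j⟩ hij hne
    rw [h i (antidiagonal.fst_le hij), iterate_map_zero, smul_zero, smul_zero]
    rintro rfl
    exact hne (by rw [antidiagonal_congr hij (by simp [add_comm])])
  · simp [add_comm]

lemma lie_iterate_iterate {y : L} {d i k t : ℕ} (hd : i + t = d)
    (hy : ∀ s, s ≠ d → ⁅D^[s] y, y⁆ = 0) :
    ⁅D^[i] y, D^[k + t] y⁆ = ((-1 : R) ^ t * ((k + t).choose t : R)) • D^[k] ⁅D^[d] y, y⁆ := by
  rw [lie_iterate_eq_single, ← Function.iterate_add_apply, add_comm t i, hd]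
  intro s _ hs
  rw [← Function.iterate_add_apply]
  exact hy _ (by omega)

lemma lie_iterate_self_eq_zero {y : L} {d : ℕ} (hlt : ∀ s < d, ⁅D^[s] y, y⁆ = 0)
    (hd : D^[d + 1] y = 0) {s : ℕ} (hs : s ≠ d) : ⁅D^[s] y, y⁆ = 0 := by
  obtain hs | hs := hs.lt_or_gt
  · exact hlt s hs
  · obtain ⟨j, rfl⟩ := Nat.exists_eq_add_of_le' (Nat.succ_le_of_lt hs)
    rw [Function.iterate_add_apply, hd, iterate_map_zero, zero_lie]

variable (D) in
/-- The iterate `D^[p ^ e]` of a derivation `D` of a Lie algebra of prime characteristic `p`,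
which is again a derivation. -/
def derivationPrimePow {p : ℕ} [CharP R p] (hp : p.Prime) (e : ℕ) : LieDerivation R L L where
  toLinearMap := (D : Module.End R L) ^ p ^ e
  leibniz' a b := by
    have hq : 0 < p ^ e := pow_pos hp.pos e
    simp only [Module.End.pow_apply, LieDerivation.coeFn_coe, LieDerivation.iterate_apply_lie]
    rw [Finset.sum_eq_add (0, p ^ e) (p ^ e, 0)]
    · simp [sub_eq_add_neg]
    · simp [hq.ne]
    · rintro ⟨i, j⟩ hij ⟨hi, hj⟩
      have hij := mem_antidiagonal.1 hij
      rw [← Nat.cast_smul_eq_nsmul R, (CharP.cast_eq_zero_iff R p _).2, zero_smul]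
      refine hp.dvd_choose_pow ?_ ?_
      · rintro rfl; exact hi (by simp_all)
      · rintro rfl; exact hj (by simp_all)
    · simp
    · simp

lemma derivationPrimePow_apply {p : ℕ} [CharP R p] (hp : p.Prime) (e : ℕ) (u : L) :
    derivationPrimePow D hp e u = D^[p ^ e] u :=
  Module.End.pow_apply (D : Module.End R L) (p ^ e) u

end Derivation

section FirstConstituent

variable {F L : Type*} [Field F] [LieRing L] [LieAlgebra F L] {D : LieDerivation F L L} {y : L}
  {d : ℕ}

lemma neg_one_pow_mul_choose_eq_neg_one (hy : ∀ s, s ≠ d → ⁅D^[s] y, y⁆ = 0) {k t : ℕ}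
    (hkt : k + t = d) (hk : D^[k] ⁅D^[d] y, y⁆ ≠ 0) :
    (-1 : F) ^ t * ((k + t).choose t : F) = -1 := by
  have hleft : ⁅D^[d] y, D^[k] y⁆ = D^[k] ⁅D^[d] y, y⁆ := by
    simpa using lie_iterate_iterate (k := k) (add_zero d) hy
  have hright := lie_iterate_iterate (k := k) hkt hy
  rw [hkt, ← lie_skew, hleft, ← neg_one_smul F] at hright
  rw [hkt]
  exact (smul_left_injective F hk hright).symm

lemma choose_eq_neg_one_pow (hy : ∀ s, s ≠ d → ⁅D^[s] y, y⁆ = 0) {k : ℕ} (hkd : k ≤ d)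
    (hk : D^[k] ⁅D^[d] y, y⁆ ≠ 0) : (d.choose k : F) = (-1) ^ k := by
  obtain ⟨t, rfl⟩ := Nat.exists_eq_add_of_le hkd
  have hw : ⁅D^[k + t] y, y⁆ ≠ 0 := fun h => hk (by rw [h, iterate_map_zero])
  have hchoose := neg_one_pow_mul_choose_eq_neg_one hy rfl hk
  have hsign : (-1 : F) ^ (k + t) = -1 := by
    simpa using neg_one_pow_mul_choose_eq_neg_one hy (zero_add (k + t)) hw
  refine mul_left_cancel₀ (pow_ne_zero t (neg_ne_zero.2 one_ne_zero)) ?_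
  rw [Nat.choose_symm_add, hchoose, ← pow_add, add_comm t k, hsign]

variable {p : ℕ} [CharP F p]

lemma dvd_choose_of_iterate_ne_zero (hy : ∀ s, s ≠ d → ⁅D^[s] y, y⁆ = 0) {k : ℕ}
    (hk0 : 0 < k) (hkd : k ≤ d) (hk : D^[k] ⁅D^[d] y, y⁆ ≠ 0) : p ∣ (d + 1).choose k := by
  obtain ⟨k, rfl⟩ := Nat.exists_eq_add_one.2 hk0
  have hk' : D^[k] ⁅D^[d] y, y⁆ ≠ 0 := fun h =>
    hk (by rw [Function.iterate_succ_apply', h, map_zero])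
  rw [← CharP.cast_eq_zero_iff F p, Nat.choose_succ_succ', Nat.cast_add,
    choose_eq_neg_one_pow hy (by omega) hk', choose_eq_neg_one_pow hy hkd hk]
  ring

lemma dvd_choose_of_lie_iterate_ne_zero (hy : ∀ s, s ≠ d → ⁅D^[s] y, y⁆ = 0) {k t : ℕ}
    (ht : 0 < t) (hkt : k + t < d) (hk : ⁅D^[k] ⁅D^[d] y, y⁆, y⁆ ≠ 0) :
    p ∣ (k + t).choose t := by
  have hjacobi := leibniz_lie (D^[d - t] y) (D^[k + t] y) y
  rw [hy _ hkt.ne, hy (d - t) (by omega), lie_zero, lie_zero, add_zero,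
    lie_iterate_iterate (by omega) hy, smul_lie] at hjacobi
  rw [← CharP.cast_eq_zero_iff F p]
  exact (mul_eq_zero.1 ((smul_eq_zero.1 hjacobi.symm).resolve_right hk)).resolve_left
    (pow_ne_zero t (neg_ne_zero.2 one_ne_zero))

lemma exists_eq_two_mul_prime_pow_of_eq_prime_pow (hp : p.Prime)
    (hy : ∀ s, s ≠ d → ⁅D^[s] y, y⁆ = 0) (hw : ⁅D^[d] y, y⁆ ≠ 0) {s : ℕ} (hs : d + 1 = p ^ s) :
    ∃ r, d + 1 = 2 * p ^ r := by
  have hd : d ≠ 0 := by rintro rfl; exact hw (lie_self y)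
  -- Comparing `(-1) ^ d = -1` with `(-1) ^ p ^ s = -1` forces characteristic two.
  have hsign : (-1 : F) ^ d = -1 := by
    simpa using neg_one_pow_mul_choose_eq_neg_one hy (zero_add d) hw
  have hsign' : (-1 : F) ^ (d + 1) = -1 := by
    have := Fact.mk hp
    rw [hs, neg_one_pow_char_pow]
  have htwo : ((2 : ℕ) : F) = 0 := by
    rw [pow_succ, hsign] at hsign'
    push_cast
    linear_combination hsign'
  obtain rfl : p = 2 := (Nat.prime_dvd_prime_iff_eq hp Nat.prime_two).1
    ((CharP.cast_eq_zero_iff F p 2).1 htwo)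
  have hs0 : s ≠ 0 := by rintro rfl; exact hd (by simpa using hs)
  exact ⟨s - 1, by rw [hs, mul_pow_sub_one hs0]⟩

lemma exists_eq_two_mul_prime_pow (hp : p.Prime) (hy : ∀ s, s ≠ d → ⁅D^[s] y, y⁆ = 0)
    (hw : ⁅D^[d] y, y⁆ ≠ 0)
    (hnd : ∀ k, D^[k] ⁅D^[d] y, y⁆ ≠ 0 →
      D^[k + 1] ⁅D^[d] y, y⁆ ≠ 0 ∨ ⁅D^[k] ⁅D^[d] y, y⁆, y⁆ ≠ 0) :
    ∃ s, d + 1 = 2 * p ^ s := by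
  classical
  have hex : ∃ k, k < d → ⁅D^[k] ⁅D^[d] y, y⁆, y⁆ ≠ 0 := ⟨d, fun h => absurd h d.lt_irrefl⟩
  obtain ⟨k₀, hk₀, hmin⟩ : ∃ k₀, (k₀ < d → ⁅D^[k₀] ⁅D^[d] y, y⁆, y⁆ ≠ 0) ∧
      ∀ j < k₀, j < d ∧ ⁅D^[j] ⁅D^[d] y, y⁆, y⁆ = 0 :=
    ⟨Nat.find hex, Nat.find_spec hex, fun j hj => by simpa using Nat.find_min hex hj⟩
  have hk₀d : k₀ ≤ d := not_lt.1 fun h => d.lt_irrefl (hmin d h).1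
  have hne : ∀ k ≤ k₀, D^[k] ⁅D^[d] y, y⁆ ≠ 0 := by
    intro k
    induction k with
    | zero => exact fun _ => hw
    | succ k ih =>
      exact fun hk => (hnd k (ih (by omega))).resolve_right (not_not.2 (hmin k (by omega)).2)
  obtain ⟨s, hs | hs⟩ := eq_prime_pow_or_eq_two_mul_prime_pow hp d.succ_ne_zero
    (fun j hj hjk => dvd_choose_of_iterate_ne_zero hy hj (hjk.trans hk₀d) (hne j hjk))
    (fun t ht hkt => dvd_choose_of_lie_iterate_ne_zero hy ht (by omega) (hk₀ (by omega)))
  · exact exists_eq_two_mul_prime_pow_of_eq_prime_pow hp hy hw hs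
  · exact ⟨s, hs⟩

end FirstConstituent

section AdjointDerivation

open LieDerivation (ad)

section CommRing

variable {R L : Type*} [CommRing R] [LieRing L] [LieAlgebra R L]

lemma iterate_ad_ad (v u : L) (k : ℕ) :
    (ad R (LieDerivation R L L) (ad R L v))^[k] (ad R L u) = ad R L ((ad R L v)^[k] u) := by
  induction k with
  | zero => rfl
  | succ k ih =>
    rw [Function.iterate_succ_apply', ih, Function.iterate_succ_apply',
      LieDerivation.ad_apply_apply, LieDerivation.ad_apply_apply, LieHom.map_lie]

lemma ad_lie_derivation (E : LieDerivation R L L) (u : L) : ⁅ad R L u, E⁆ = -ad R L (E u) := by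
  rw [← lie_skew, LieDerivation.lie_der_ad_eq_ad_der]

lemma iterate_succ_ad_derivation (E : LieDerivation R L L) (v : L) (k : ℕ) :
    (ad R (LieDerivation R L L) (ad R L v))^[k + 1] E = -ad R L ((ad R L v)^[k] (E v)) := by
  rw [Function.iterate_succ_apply, LieDerivation.ad_apply_apply, ad_lie_derivation,
    iterate_map_neg, iterate_ad_ad]

end CommRing

variable {F L : Type*} [Field F] [LieRing L] [LieAlgebra F L] {p : ℕ} [CharP F p]

lemma exists_add_three_eq_two_mul_prime_pow_of_derivation (hp : p.Prime)
    {E : LieDerivation F L L} {v w : L} {m : ℕ} (hE : ∀ k ≤ m, E ((ad F L v)^[k] (E v)) = 0)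
    (hlast : (ad F L v)^[m + 2] (E v) = 0) (hw : E ((ad F L v)^[m + 1] (E v)) = w)
    (hw0 : ad F L w ≠ 0)
    (hnd : ∀ k, ad F L ((ad F L v)^[k] w) ≠ 0 →
      ad F L ((ad F L v)^[k + 1] w) ≠ 0 ∨ ad F L (E ((ad F L v)^[k] w)) ≠ 0) :
    ∃ s, m + 3 = 2 * p ^ s := by
  have hlie : ∀ k, ⁅(ad F (LieDerivation F L L) (ad F L v))^[k + 1] E, E⁆ =
      ad F L (E ((ad F L v)^[k] (E v))) := fun k => by
    rw [iterate_succ_ad_derivation, neg_lie, ad_lie_derivation, neg_neg]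
  have hself : ∀ s, s ≠ m + 2 → ⁅(ad F (LieDerivation F L L) (ad F L v))^[s] E, E⁆ = 0 :=
    fun s => lie_iterate_self_eq_zero
      (fun s hs => by
        cases s with
        | zero => exact lie_self E
        | succ k => rw [hlie, hE k (by omega), map_zero])
      (by rw [iterate_succ_ad_derivation, hlast, map_zero, neg_zero])
  have hwE : ⁅(ad F (LieDerivation F L L) (ad F L v))^[m + 2] E, E⁆ = ad F L w := by
    rw [hlie, hw]
  refine exists_eq_two_mul_prime_pow hp hself (hwE ▸ hw0) fun k hk => ?_
  rw [hwE] at hk ⊢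
  rw [iterate_ad_ad] at hk ⊢
  rw [iterate_ad_ad, ad_lie_derivation, neg_ne_zero]
  exact hnd k hk

end AdjointDerivation

section LieSpan

variable {R L M : Type*} [CommRing R] [LieRing L] [LieAlgebra R L] [AddCommGroup M] [Module R M]
  [LieRingModule L M] [LieModule R L M] {s : Set L}

lemma lie_mem_of_mem_lieSpan {N : Submodule R M} (hs : ∀ a ∈ s, ∀ n ∈ N, ⁅a, n⁆ ∈ N) {a : L}
    (ha : a ∈ LieSubalgebra.lieSpan R L s) {n : M} (hn : n ∈ N) : ⁅a, n⁆ ∈ N := by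
  induction ha using LieSubalgebra.lieSpan_induction generalizing n with
  | mem a ha => exact hs a ha n hn
  | zero => simp
  | add a b _ _ iha ihb => simpa only [add_lie] using N.add_mem (iha hn) (ihb hn)
  | smul r a _ ih => simpa only [smul_lie] using N.smul_mem r (ih hn)
  | lie a b _ _ iha ihb => simpa only [lie_lie] using N.sub_mem (iha (ihb hn)) (ihb (iha hn))

lemma lieSpan_le_of_lie_mem {N : Submodule R L} (hsub : s ⊆ N)
    (hs : ∀ a ∈ s, ∀ n ∈ N, ⁅a, n⁆ ∈ N) : (LieSubalgebra.lieSpan R L s).toSubmodule ≤ N := by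
  intro a ha
  induction ha using LieSubalgebra.lieSpan_induction with
  | mem a ha => exact hsub ha
  | zero => exact N.zero_mem
  | add a b _ _ iha ihb => exact N.add_mem iha ihb
  | smul r a _ ih => exact N.smul_mem r ih
  | lie a b ha _ _ ihb => exact lie_mem_of_mem_lieSpan hs ha ihb

end LieSpan

section TwoStepCentralizer

variable {F L : Type*} [Field F] [LieRing L] [LieAlgebra F L] {𝒜 : ℕ → Submodule F L}

lemma twoStepCentralizer_le (i : ℕ) : twoStepCentralizer 𝒜 i ≤ 𝒜 1 :=
  fun _ ha => ha.1

variable [GradedLieAlgebra 𝒜]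

namespace IsMaximalClass

lemma finiteDimensional (hL : IsMaximalClass 𝒜) (i : ℕ) : FiniteDimensional F (𝒜 i) := by
  refine Module.rank_lt_aleph0_iff.1 ?_
  match i with
  | 0 => exact hL.zero_eq_bot ▸ rank_bot F L ▸ Cardinal.aleph0_pos
  | 1 => exact hL.rank_one ▸ Cardinal.ofNat_lt_aleph0
  | i + 2 => exact (hL.rank_le_one _ (by omega)).trans_lt Cardinal.one_lt_aleph0

lemma finrank_one (hL : IsMaximalClass 𝒜) : Module.finrank F (𝒜 1) = 2 :=
  Module.finrank_eq_of_rank_eq hL.rank_one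

lemma exists_lie_ne_zero (hL : IsMaximalClass 𝒜) (hinf : ¬ FiniteDimensional F L) {i : ℕ}
    (hi : 1 ≤ i) : ∃ u ∈ 𝒜 i, ∃ v ∈ 𝒜 1, ⁅u, v⁆ ≠ 0 := by
  by_contra! h
  have := hL.finiteDimensional
  let N := (Finset.Icc 1 i).sup 𝒜
  have hN : ∀ {j}, 1 ≤ j → j ≤ i → 𝒜 j ≤ N := fun h1 hi =>
    Finset.le_sup (Finset.mem_Icc.2 ⟨h1, hi⟩)
  have hstable : ∀ v ∈ 𝒜 1, N ≤ N.comap (LieAlgebra.ad F L v : L →ₗ[F] L) := by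
    refine fun v hv => Finset.sup_le fun j hj u hu => ?_
    obtain ⟨h1j, hji⟩ := Finset.mem_Icc.1 hj
    rw [Submodule.mem_comap, LieAlgebra.ad_apply]
    obtain rfl | hji := hji.eq_or_lt
    · simp [← lie_skew v u, h u hu v hv]
    · exact hN (by omega) (by omega) (SetLike.GradedBracket.bracket_mem hv hu)
  have htop : N = ⊤ := by
    rw [eq_top_iff, ← LieSubalgebra.top_toSubmodule, ← hL.generated]
    exact lieSpan_le_of_lie_mem (hN le_rfl hi) fun v hv _ hn => hstable v hv hn
  have hfin : FiniteDimensional F N := Submodule.finiteDimensional_finset_sup _ _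
  exact hinf (Module.finite_def.2 (htop ▸ Module.Finite.iff_fg.1 hfin))

lemma exists_ne_zero (hL : IsMaximalClass 𝒜) (hinf : ¬ FiniteDimensional F L) {i : ℕ}
    (hi : 1 ≤ i) : ∃ u ∈ 𝒜 i, u ≠ 0 := by
  obtain ⟨u, hu, v, -, huv⟩ := hL.exists_lie_ne_zero hinf hi
  exact ⟨u, hu, by rintro rfl; exact huv (zero_lie v)⟩

lemma finrank_eq_one (hL : IsMaximalClass 𝒜) (hinf : ¬ FiniteDimensional F L) {i : ℕ}
    (hi : 2 ≤ i) : Module.finrank F (𝒜 i) = 1 := by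
  have := hL.finiteDimensional i
  obtain ⟨u, hu, hu0⟩ := hL.exists_ne_zero hinf (by omega : 1 ≤ i)
  refine le_antisymm (Module.finrank_le_of_rank_le (by simpa using hL.rank_le_one i hi)) ?_
  exact Module.finrank_pos_iff_exists_ne_zero.2 ⟨⟨u, hu⟩, by simpa using hu0⟩

lemma mem_twoStepCentralizer_iff (hL : IsMaximalClass 𝒜) (hinf : ¬ FiniteDimensional F L) {i : ℕ}
    (hi : 2 ≤ i) {u a : L} (hu : u ∈ 𝒜 i) (hu0 : u ≠ 0) :
    a ∈ twoStepCentralizer 𝒜 i ↔ a ∈ 𝒜 1 ∧ ⁅u, a⁆ = 0 := by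
  refine ⟨fun h => ⟨h.1, h.2 u hu⟩, fun h => ⟨h.1, fun v hv => ?_⟩⟩
  rw [eq_span_singleton_of_mem_of_finrank_eq_one (hL.finrank_eq_one hinf hi) hu hu0] at hv
  obtain ⟨c, rfl⟩ := Submodule.mem_span_singleton.1 hv
  rw [smul_lie, h.2, smul_zero]

lemma finrank_twoStepCentralizer (hL : IsMaximalClass 𝒜) (hinf : ¬ FiniteDimensional F L) {i : ℕ}
    (hi : 2 ≤ i) : Module.finrank F (twoStepCentralizer 𝒜 i) = 1 := by
  have := hL.finiteDimensional 1
  obtain ⟨u, hu, v, hv, huv⟩ := hL.exists_lie_ne_zero hinf (by omega : 1 ≤ i)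
  have hu0 : u ≠ 0 := by rintro rfl; exact huv (zero_lie v)
  let f : 𝒜 1 →ₗ[F] 𝒜 (i + 1) := (LieAlgebra.ad F L u : L →ₗ[F] L).restrict
    fun a ha => SetLike.GradedBracket.bracket_mem hu ha
  have hf : f ≠ 0 := fun h =>
    huv (congrArg Subtype.val (LinearMap.congr_fun h ⟨v, hv⟩))
  have hker : LinearMap.ker f = (twoStepCentralizer 𝒜 i).comap (𝒜 1).subtype := by
    ext a
    rw [LinearMap.mem_ker, Submodule.mem_comap, hL.mem_twoStepCentralizer_iff hinf hi hu hu0,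
      Subtype.ext_iff]
    exact (and_iff_right a.2).symm
  have hrank := f.finrank_range_add_finrank_ker
  rw [LinearMap.range_eq_top.2 (surjective_of_nonzero_of_finrank_eq_one
      (hL.finrank_eq_one hinf (by omega)) hf), finrank_top, hL.finrank_eq_one hinf (by omega),
    hL.finrank_one, hker,
    (Submodule.comapSubtypeEquivOfLe (twoStepCentralizer_le i)).finrank_eq] at hrank
  omega

lemma exists_ne_zero_mem_twoStepCentralizer (hL : IsMaximalClass 𝒜)
    (hinf : ¬ FiniteDimensional F L) {i : ℕ} (hi : 2 ≤ i) :
    ∃ a ∈ twoStepCentralizer 𝒜 i, a ≠ 0 :=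
  Submodule.exists_mem_ne_zero_of_ne_bot fun h => zero_ne_one <| by
    rw [← finrank_bot F L, ← h, hL.finrank_twoStepCentralizer hinf hi]

lemma twoStepCentralizer_eq_of_mem (hL : IsMaximalClass 𝒜) (hinf : ¬ FiniteDimensional F L)
    {i j : ℕ} (hi : 2 ≤ i) (hj : 2 ≤ j) {a : L} (ha0 : a ≠ 0)
    (hai : a ∈ twoStepCentralizer 𝒜 i) (haj : a ∈ twoStepCentralizer 𝒜 j) :
    twoStepCentralizer 𝒜 i = twoStepCentralizer 𝒜 j := by
  rw [eq_span_singleton_of_mem_of_finrank_eq_one (hL.finrank_twoStepCentralizer hinf hi) hai ha0,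
    eq_span_singleton_of_mem_of_finrank_eq_one (hL.finrank_twoStepCentralizer hinf hj) haj ha0]

lemma twoStepCentralizer_sup_eq (hL : IsMaximalClass 𝒜) (hinf : ¬ FiniteDimensional F L)
    {i j : ℕ} (hi : 2 ≤ i) (hj : 2 ≤ j)
    (hij : twoStepCentralizer 𝒜 i ≠ twoStepCentralizer 𝒜 j) :
    twoStepCentralizer 𝒜 i ⊔ twoStepCentralizer 𝒜 j = 𝒜 1 := by
  have := hL.finiteDimensional 1
  have hfin : ∀ k, FiniteDimensional F (twoStepCentralizer 𝒜 k) := fun k =>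
    Submodule.finiteDimensional_of_le (twoStepCentralizer_le k)
  have hinter : twoStepCentralizer 𝒜 i ⊓ twoStepCentralizer 𝒜 j = ⊥ :=
    (Submodule.eq_bot_iff _).2 fun a ha => by_contra fun ha0 =>
      hij (hL.twoStepCentralizer_eq_of_mem hinf hi hj ha0 ha.1 ha.2)
  refine Submodule.eq_of_le_of_finrank_eq
    (sup_le (twoStepCentralizer_le i) (twoStepCentralizer_le j)) ?_
  have hsum := Submodule.finrank_sup_add_finrank_inf_eq (twoStepCentralizer 𝒜 i)
    (twoStepCentralizer 𝒜 j)
  rw [hinter, finrank_bot, hL.finrank_twoStepCentralizer hinf hi,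
    hL.finrank_twoStepCentralizer hinf hj] at hsum
  rw [hL.finrank_one]
  omega

end IsMaximalClass

end TwoStepCentralizer

section StandardPair

open LieDerivation (ad)

variable {F L : Type*} [Field F] [LieRing L] [LieAlgebra F L] {𝒜 : ℕ → Submodule F L}

lemma iterate_ad_mem [GradedLieAlgebra 𝒜] {i j : ℕ} {u v : L} (hu : u ∈ 𝒜 i) (hv : v ∈ 𝒜 j)
    (k : ℕ) : (ad F L v)^[k] u ∈ 𝒜 (i + k * j) := by
  induction k with
  | zero => simpa using hu
  | succ k ih =>
    rw [Function.iterate_succ_apply', LieDerivation.ad_apply_apply,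
      show i + (k + 1) * j = j + (i + k * j) by ring]
    exact SetLike.GradedBracket.bracket_mem hv ih

/-- An infinite-dimensional algebra of maximal class with parameter `q`, together with generators
`x` of `C_{2q}` and `y` of `C_2`; these form a basis of `L_1`. -/
structure IsStandardPair (𝒜 : ℕ → Submodule F L) [GradedLieAlgebra 𝒜] (q : ℕ) (x y : L) :
    Prop where
  isMaximalClass : IsMaximalClass 𝒜
  not_finiteDimensional : ¬ FiniteDimensional F L
  isParameter : IsParameter 𝒜 q
  x_mem : x ∈ twoStepCentralizer 𝒜 (2 * q)
  x_ne_zero : x ≠ 0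
  y_mem : y ∈ twoStepCentralizer 𝒜 2
  y_ne_zero : y ≠ 0

variable [GradedLieAlgebra 𝒜] {q : ℕ} {x y : L}

lemma IsMaximalClass.exists_isStandardPair (hL : IsMaximalClass 𝒜)
    (hinf : ¬ FiniteDimensional F L) (hq : IsParameter 𝒜 q) : ∃ x y, IsStandardPair 𝒜 q x y := by
  obtain ⟨x, hx, hx0⟩ := hL.exists_ne_zero_mem_twoStepCentralizer hinf hq.1
  obtain ⟨y, hy, hy0⟩ := hL.exists_ne_zero_mem_twoStepCentralizer hinf le_rfl
  exact ⟨x, y, hL, hinf, hq, hx, hx0, hy, hy0⟩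

namespace IsStandardPair

lemma two_le (h : IsStandardPair 𝒜 q x y) : 2 ≤ q := by
  obtain ⟨h2, hne, -⟩ := h.isParameter
  have : q ≠ 1 := fun hq => hne (by rw [hq])
  omega

lemma two_mul_le (h : IsStandardPair 𝒜 q x y) {i : ℕ} (hi : 2 ≤ i)
    (hC : twoStepCentralizer 𝒜 i ≠ twoStepCentralizer 𝒜 2) : 2 * q ≤ i :=
  not_lt.1 fun hlt => hC (h.isParameter.2.2 i hi hlt)

lemma lie_y_eq_zero (h : IsStandardPair 𝒜 q x y) {i : ℕ} {u : L} (hu : u ∈ 𝒜 i)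
    (hC : twoStepCentralizer 𝒜 i = twoStepCentralizer 𝒜 2) : ⁅u, y⁆ = 0 :=
  (hC ▸ h.y_mem).2 u hu

lemma x_lie_eq_zero (h : IsStandardPair 𝒜 q x y) {i : ℕ} {u : L} (hu : u ∈ 𝒜 i)
    (hC : twoStepCentralizer 𝒜 i = twoStepCentralizer 𝒜 (2 * q)) : ⁅x, u⁆ = 0 := by
  have hx : x ∈ twoStepCentralizer 𝒜 i := hC ▸ h.x_mem
  rw [← lie_skew, hx.2 u hu, neg_zero]

lemma lie_y_ne_zero (h : IsStandardPair 𝒜 q x y) {i : ℕ} {u : L} (hi : 2 ≤ i) (hu : u ∈ 𝒜 i)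
    (hu0 : u ≠ 0) (hC : twoStepCentralizer 𝒜 i ≠ twoStepCentralizer 𝒜 2) : ⁅u, y⁆ ≠ 0 := by
  have hL := h.isMaximalClass
  have hinf := h.not_finiteDimensional
  refine fun huy => hC (hL.twoStepCentralizer_eq_of_mem hinf hi le_rfl h.y_ne_zero ?_ h.y_mem)
  exact (hL.mem_twoStepCentralizer_iff hinf hi hu hu0).2 ⟨h.y_mem.1, huy⟩

lemma x_lie_ne_zero (h : IsStandardPair 𝒜 q x y) {i : ℕ} {u : L} (hi : 2 ≤ i) (hu : u ∈ 𝒜 i)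
    (hu0 : u ≠ 0) (hC : twoStepCentralizer 𝒜 i = twoStepCentralizer 𝒜 2) : ⁅x, u⁆ ≠ 0 := by
  have hL := h.isMaximalClass
  have hinf := h.not_finiteDimensional
  refine fun hxu => h.isParameter.2.1 (Eq.trans ?_ hC)
  refine hL.twoStepCentralizer_eq_of_mem hinf h.isParameter.1 hi h.x_ne_zero h.x_mem ?_
  exact (hL.mem_twoStepCentralizer_iff hinf hi hu hu0).2
    ⟨h.x_mem.1, by rw [← lie_skew, hxu, neg_zero]⟩

lemma exists_smul_add_smul_eq (h : IsStandardPair 𝒜 q x y) {v : L} (hv : v ∈ 𝒜 1) :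
    ∃ r s : F, r • x + s • y = v := by
  have hL := h.isMaximalClass
  have hinf := h.not_finiteDimensional
  rw [← hL.twoStepCentralizer_sup_eq hinf h.isParameter.1 le_rfl h.isParameter.2.1] at hv
  obtain ⟨a, ha, b, hb, rfl⟩ := Submodule.mem_sup.1 hv
  rw [eq_span_singleton_of_mem_of_finrank_eq_one
    (hL.finrank_twoStepCentralizer hinf h.isParameter.1) h.x_mem h.x_ne_zero] at ha
  rw [eq_span_singleton_of_mem_of_finrank_eq_one
    (hL.finrank_twoStepCentralizer hinf le_rfl) h.y_mem h.y_ne_zero] at hb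
  obtain ⟨r, rfl⟩ := Submodule.mem_span_singleton.1 ha
  obtain ⟨s, rfl⟩ := Submodule.mem_span_singleton.1 hb
  exact ⟨r, s, rfl⟩

lemma lie_ne_zero (h : IsStandardPair 𝒜 q x y) : ⁅x, y⁆ ≠ 0 := by
  intro hxy
  have hyx : ⁅y, x⁆ = 0 := by rw [← lie_skew, hxy, neg_zero]
  obtain ⟨u, hu, v, hv, huv⟩ :=
    h.isMaximalClass.exists_lie_ne_zero h.not_finiteDimensional le_rfl
  obtain ⟨r, s, rfl⟩ := h.exists_smul_add_smul_eq hu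
  obtain ⟨r', s', rfl⟩ := h.exists_smul_add_smul_eq hv
  exact huv (by simp [hxy, hyx])

lemma ad_ne_zero (h : IsStandardPair 𝒜 q x y) {i : ℕ} {u : L} (hi : 2 ≤ i) (hu : u ∈ 𝒜 i)
    (hu0 : u ≠ 0) : ad F L u ≠ 0 := by
  intro had
  have hlie : ∀ v : L, ⁅u, v⁆ = 0 := fun v => by
    rw [← LieDerivation.ad_apply_apply (R := F), had, LieDerivation.zero_apply]
  by_cases hC : twoStepCentralizer 𝒜 i = twoStepCentralizer 𝒜 2
  · exact h.x_lie_ne_zero hi hu hu0 hC (by rw [← lie_skew, hlie, neg_zero])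
  · exact h.lie_y_ne_zero hi hu hu0 hC (hlie y)

lemma iterate_mem (h : IsStandardPair 𝒜 q x y) {i : ℕ} {u : L} (hu : u ∈ 𝒜 i) (k : ℕ) :
    (ad F L x)^[k] u ∈ 𝒜 (i + k) := by
  simpa using iterate_ad_mem hu h.x_mem.1 k

lemma iterate_ne_zero (h : IsStandardPair 𝒜 q x y) {i : ℕ} {u : L} (hi : 2 ≤ i) (hu : u ∈ 𝒜 i)
    (hu0 : u ≠ 0) {k : ℕ}
    (hC : ∀ s < k, twoStepCentralizer 𝒜 (i + s) = twoStepCentralizer 𝒜 2) :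
    (ad F L x)^[k] u ≠ 0 := by
  induction k with
  | zero => exact hu0
  | succ k ih =>
    rw [Function.iterate_succ_apply', LieDerivation.ad_apply_apply]
    exact h.x_lie_ne_zero (by omega) (h.iterate_mem hu k) (ih fun s hs => hC s (by omega))
      (hC k k.lt_succ_self)

lemma iterate_y_mem (h : IsStandardPair 𝒜 q x y) (k : ℕ) : (ad F L x)^[k] y ∈ 𝒜 (k + 1) :=
  add_comm 1 k ▸ h.iterate_mem h.y_mem.1 k

lemma iterate_y_ne_zero (h : IsStandardPair 𝒜 q x y) {k : ℕ} (hk : k < 2 * q) :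
    (ad F L x)^[k] y ≠ 0 := by
  cases k with
  | zero => exact h.y_ne_zero
  | succ k =>
    rw [Function.iterate_succ_apply, LieDerivation.ad_apply_apply]
    exact h.iterate_ne_zero (i := 2) le_rfl (SetLike.GradedBracket.bracket_mem h.x_mem.1 h.y_mem.1)
      h.lie_ne_zero fun s hs => h.isParameter.2.2 _ (by omega) (by omega)

lemma lie_iterate_y_y_eq_zero (h : IsStandardPair 𝒜 q x y) {k : ℕ} (hk : k + 1 < 2 * q) :
    ⁅(ad F L x)^[k] y, y⁆ = 0 := by
  cases k with
  | zero => exact lie_self y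
  | succ k => exact h.lie_y_eq_zero (h.iterate_y_mem _) (h.isParameter.2.2 _ (by omega) hk)

theorem exists_eq_prime_pow (h : IsStandardPair 𝒜 q x y) {p : ℕ} [CharP F p] (hp : p.Prime) :
    ∃ e, q = p ^ e := by
  obtain ⟨d, hd⟩ : ∃ d, 2 * q = d + 1 := ⟨2 * q - 1, by have := h.two_le; omega⟩
  have hmem : (ad F L x)^[d] y ∈ 𝒜 (2 * q) := hd ▸ h.iterate_y_mem d
  have hself : ∀ s, s ≠ d → ⁅(ad F L x)^[s] y, y⁆ = 0 := fun s =>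
    lie_iterate_self_eq_zero (fun s hs => h.lie_iterate_y_y_eq_zero (by omega)) <| by
      rw [Function.iterate_succ_apply', LieDerivation.ad_apply_apply, h.x_lie_eq_zero hmem rfl]
  set w := ⁅(ad F L x)^[d] y, y⁆
  have hw : w ∈ 𝒜 (2 * q + 1) := SetLike.GradedBracket.bracket_mem hmem h.y_mem.1
  have hw0 : w ≠ 0 :=
    h.lie_y_ne_zero h.isParameter.1 hmem (h.iterate_y_ne_zero (by omega)) h.isParameter.2.1
  obtain ⟨e, he⟩ := exists_eq_two_mul_prime_pow (F := F) hp hself hw0 fun k hk => by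
    by_cases hC : twoStepCentralizer 𝒜 (2 * q + 1 + k) = twoStepCentralizer 𝒜 2
    · left
      rw [Function.iterate_succ_apply', LieDerivation.ad_apply_apply]
      exact h.x_lie_ne_zero (by omega) (h.iterate_mem hw k) hk hC
    · exact .inr (h.lie_y_ne_zero (by omega) (h.iterate_mem hw k) hk hC)
  exact ⟨e, by omega⟩

lemma lie_iterate_y_eq (h : IsStandardPair 𝒜 q x y) {i k t : ℕ} {u : L} (hu : u ∈ 𝒜 i)
    (hC : ∀ s ≤ k + t, s ≠ t → twoStepCentralizer 𝒜 (i + s) = twoStepCentralizer 𝒜 2) :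
    ⁅u, (ad F L x)^[k + t] y⁆ =
      ((-1 : F) ^ t * ((k + t).choose t : F)) • (ad F L x)^[k] ⁅(ad F L x)^[t] u, y⁆ :=
  lie_iterate_eq_single fun s hs hst => h.lie_y_eq_zero (h.iterate_mem hu s) (hC s hs hst)

lemma lie_iterate_mem (h : IsStandardPair 𝒜 q x y) {i : ℕ} {u : L} (hu : u ∈ 𝒜 i) (t : ℕ) :
    ⁅(ad F L x)^[t] u, y⁆ ∈ 𝒜 (i + t + 1) :=
  SetLike.GradedBracket.bracket_mem (h.iterate_mem hu t) h.y_mem.1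

lemma iterate_lie_iterate_ne_zero (h : IsStandardPair 𝒜 q x y) {i k t : ℕ} {u : L} (hi : 2 ≤ i)
    (hu : u ∈ 𝒜 i) (hu0 : u ≠ 0)
    (hC : ∀ s ≤ k + t, s ≠ t → twoStepCentralizer 𝒜 (i + s) = twoStepCentralizer 𝒜 2)
    (ht : twoStepCentralizer 𝒜 (i + t) ≠ twoStepCentralizer 𝒜 2) :
    (ad F L x)^[k] ⁅(ad F L x)^[t] u, y⁆ ≠ 0 := by
  refine h.iterate_ne_zero (by omega) (h.lie_iterate_mem hu t) ?_ fun s hs => ?_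
  · refine h.lie_y_ne_zero (by omega) (h.iterate_mem hu t) ?_ ht
    exact h.iterate_ne_zero hi hu hu0 fun s hs => hC s (by omega) hs.ne
  · rw [show i + t + 1 + s = i + (t + 1 + s) by ring]
    exact hC _ (by omega) (by omega)

lemma dvd_choose_of_twoStepCentralizer_ne (h : IsStandardPair 𝒜 q x y) {p : ℕ} [CharP F p]
    {i k t : ℕ} (hi : 2 ≤ i)
    (hC : ∀ s ≤ k + t, s ≠ t → twoStepCentralizer 𝒜 (i + s) = twoStepCentralizer 𝒜 2)
    (ht0 : 0 < t) (ht : twoStepCentralizer 𝒜 (i + t) ≠ twoStepCentralizer 𝒜 2)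
    (hkt : twoStepCentralizer 𝒜 (i + t + 1 + k) ≠ twoStepCentralizer 𝒜 2)
    (hq : k + t + 1 < 2 * q) : p ∣ (k + t).choose t := by
  obtain ⟨u, hu, hu0⟩ :=
    h.isMaximalClass.exists_ne_zero h.not_finiteDimensional (by omega : 1 ≤ i)
  have huy : ⁅u, y⁆ = 0 := h.lie_y_eq_zero hu (hC 0 (Nat.zero_le _) ht0.ne)
  have hne := h.lie_y_ne_zero (by omega) (h.iterate_mem (h.lie_iterate_mem hu t) k)
    (h.iterate_lie_iterate_ne_zero hi hu hu0 hC ht) hkt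
  have hjacobi := leibniz_lie u ((ad F L x)^[k + t] y) y
  rw [h.lie_iterate_y_y_eq_zero hq, huy, lie_zero, lie_zero, add_zero, h.lie_iterate_y_eq hu hC,
    smul_lie] at hjacobi
  have hcoeff := (smul_eq_zero.1 hjacobi.symm).resolve_right hne
  rw [mul_eq_zero, or_iff_right (pow_ne_zero t (neg_ne_zero.2 one_ne_zero))] at hcoeff
  exact (CharP.cast_eq_zero_iff F p _).1 hcoeff

theorem twoStepCentralizer_add_eq (h : IsStandardPair 𝒜 q x y) {p : ℕ} [CharP F p]
    (hp : p.Prime) {a s : ℕ} (ha : 2 ≤ a)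
    (hC : twoStepCentralizer 𝒜 a ≠ twoStepCentralizer 𝒜 2) (hs0 : 0 < s) (hs : s < q) :
    twoStepCentralizer 𝒜 (a + s) = twoStepCentralizer 𝒜 2 := by
  induction a using Nat.strong_induction_on generalizing s with
  | _ a iha =>
    induction s using Nat.strong_induction_on with
    | _ s ihs =>
      by_contra hCs
      obtain ⟨k, rfl⟩ : ∃ k, s = k + 1 := ⟨s - 1, by omega⟩
      obtain ⟨e, hek, he⟩ := exists_prime_pow_le_not_dvd_choose hp k
      obtain ⟨i, rfl⟩ : ∃ i, a = i + p ^ e :=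
        ⟨a - p ^ e, by have := h.two_mul_le ha hC; omega⟩
      have hi := h.two_mul_le ha hC
      have he0 : 0 < p ^ e := pow_pos hp.pos e
      refine he (h.dvd_choose_of_twoStepCentralizer_ne (i := i) (by omega) (fun j hj hjt => ?_)
        he0 hC ?_ (by omega))
      · obtain hlt | hgt := hjt.lt_or_gt
        · by_contra hCj
          refine hC ?_
          rw [show i + p ^ e = i + j + (p ^ e - j) by omega]
          exact iha (i + j) (by omega) (by omega) hCj (by omega) (by omega)
        · rw [show i + j = i + p ^ e + (j - p ^ e) by omega]
          exact ihs _ (by omega) (by omega) (by omega)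
      · rwa [show i + p ^ e + 1 + k = i + p ^ e + (k + 1) by ring]

theorem iterate_ne_zero_or_lie_ne_zero (h : IsStandardPair 𝒜 q x y) {p : ℕ} [CharP F p]
    (hp : p.Prime) {e : ℕ} (hq : q = p ^ e) {i : ℕ} {u : L} (hi : 2 ≤ i) (hu : u ∈ 𝒜 i)
    (hu0 : u ≠ 0) :
    (ad F L x)^[q] u ≠ 0 ∨ ⁅u, (ad F L x)^[q - 1] y⁆ ≠ 0 := by
  by_cases hC : ∀ t < q, twoStepCentralizer 𝒜 (i + t) = twoStepCentralizer 𝒜 2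
  · exact .inl (h.iterate_ne_zero hi hu hu0 hC)
  right
  push Not at hC
  obtain ⟨t, htq, ht⟩ := hC
  -- Constituents have length at least `q`, so only one of `C_i, …, C_{i+q-1}` differs from `C_2`
  -- and a single term of the Leibniz expansion of `⁅u, (ad x)^(q-1) y⁆` survives.
  have hother : ∀ s < q, s ≠ t → twoStepCentralizer 𝒜 (i + s) = twoStepCentralizer 𝒜 2 := by
    intro s hs hst
    obtain hlt | hgt := hst.lt_or_gt
    · by_contra hCs
      refine ht ?_
      rw [show i + t = i + s + (t - s) by omega]
      exact h.twoStepCentralizer_add_eq hp (by omega) hCs (by omega) (by omega)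
    · rw [show i + s = i + t + (s - t) by omega]
      exact h.twoStepCentralizer_add_eq hp (by omega) ht (by omega) (by omega)
  obtain ⟨k, hk⟩ : ∃ k, q - 1 = k + t := ⟨q - 1 - t, by omega⟩
  have hC' : ∀ s ≤ k + t, s ≠ t → twoStepCentralizer 𝒜 (i + s) = twoStepCentralizer 𝒜 2 :=
    fun s hs => hother s (by omega)
  rw [hk, h.lie_iterate_y_eq hu hC', ← hk, hq,
    neg_one_pow_mul_choose_prime_pow_sub_one hp (hq ▸ htq), one_smul]
  exact h.iterate_lie_iterate_ne_zero hi hu hu0 hC' ht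

end IsStandardPair

end StandardPair

section Deflation

open LieDerivation (ad)

variable {F L : Type*} [Field F] [LieRing L] [LieAlgebra F L]

variable (F) in
/-- The element `v = (ad x)^(q-1) y`. With the derivation `(ad x)^q` it generates the deflation of
an algebra of maximal class with parameter `q` and standard generators `x`, `y`. -/
def deflationElt (q : ℕ) (x y : L) : L :=
  (ad F L x)^[q - 1] y

variable (F) in
/-- The elements `z_k = (ad v)^k (ad x)^q v`, where `v = deflationElt F q x y`. The derivations
`ad z_k` run through the first constituent of the deflation. -/
def deflationSeq (q : ℕ) (x y : L) (k : ℕ) : L :=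
  (ad F L (deflationElt F q x y))^[k] ((ad F L x)^[q] (deflationElt F q x y))

lemma deflationSeq_succ (q : ℕ) (x y : L) (k : ℕ) :
    deflationSeq F q x y (k + 1) = ⁅deflationElt F q x y, deflationSeq F q x y k⁆ := by
  rw [deflationSeq, Function.iterate_succ_apply', LieDerivation.ad_apply_apply, deflationSeq]

namespace IsStandardPair

variable {𝒜 : ℕ → Submodule F L} [GradedLieAlgebra 𝒜] {q : ℕ} {x y : L}

lemma deflationElt_mem (h : IsStandardPair 𝒜 q x y) : deflationElt F q x y ∈ 𝒜 q := by
  have hq := h.two_le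
  have hmem := h.iterate_y_mem (q - 1)
  rwa [Nat.sub_add_cancel (by omega)] at hmem

lemma deflationSeq_mem (h : IsStandardPair 𝒜 q x y) (k : ℕ) :
    deflationSeq F q x y k ∈ 𝒜 ((k + 2) * q) := by
  rw [show (k + 2) * q = q + q + k * q by ring]
  exact iterate_ad_mem (h.iterate_mem h.deflationElt_mem q) h.deflationElt_mem k

lemma two_le_add_two_mul (h : IsStandardPair 𝒜 q x y) (k : ℕ) : 2 ≤ (k + 2) * q :=
  le_mul_of_le_of_one_le (by omega) (by have := h.two_le; omega)

lemma iterate_deflationSeq_eq_zero (h : IsStandardPair 𝒜 q x y) {k : ℕ}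
    (hC : twoStepCentralizer 𝒜 ((k + 2) * q) = twoStepCentralizer 𝒜 (2 * q)) :
    (ad F L x)^[q] (deflationSeq F q x y k) = 0 := by
  obtain ⟨d, hd⟩ : ∃ d, q = d + 1 := ⟨q - 1, by have := h.two_le; omega⟩
  nth_rw 1 [hd]
  rw [Function.iterate_succ_apply, LieDerivation.ad_apply_apply,
    h.x_lie_eq_zero (h.deflationSeq_mem k) hC, iterate_map_zero]

lemma deflationSeq_zero_ne_zero (h : IsStandardPair 𝒜 q x y) : deflationSeq F q x y 0 ≠ 0 := by
  have hq := h.two_le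
  have := h.iterate_y_ne_zero (k := q + (q - 1)) (by omega)
  rwa [Function.iterate_add_apply] at this

variable {p : ℕ} [CharP F p]

lemma deflationSeq_ne_zero (h : IsStandardPair 𝒜 q x y) (hp : p.Prime) {k : ℕ}
    (hC : ∀ j < k, twoStepCentralizer 𝒜 ((j + 2) * q) = twoStepCentralizer 𝒜 (2 * q)) :
    deflationSeq F q x y k ≠ 0 := by
  obtain ⟨e, he⟩ := h.exists_eq_prime_pow hp
  induction k with
  | zero => exact h.deflationSeq_zero_ne_zero
  | succ k ih =>
    have hz := ih fun j hj => hC j (by omega)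
    rw [deflationSeq_succ, ← lie_skew, neg_ne_zero]
    refine (h.iterate_ne_zero_or_lie_ne_zero hp he (h.two_le_add_two_mul k) (h.deflationSeq_mem k)
      hz).resolve_left (not_not.2 ?_)
    exact h.iterate_deflationSeq_eq_zero (hC k k.lt_succ_self)

lemma deflationSeq_succ_eq_zero (h : IsStandardPair 𝒜 q x y) {k : ℕ}
    (hC : ∀ s < q, twoStepCentralizer 𝒜 ((k + 2) * q + s) = twoStepCentralizer 𝒜 2) :
    deflationSeq F q x y (k + 1) = 0 := by
  have hq := h.two_le
  rw [deflationSeq_succ, ← lie_skew, neg_eq_zero]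
  exact lie_iterate_eq_zero fun s hs =>
    h.lie_y_eq_zero (h.iterate_mem (h.deflationSeq_mem k) s) (hC s (by omega))

theorem exists_add_three_eq_two_mul_prime_pow (h : IsStandardPair 𝒜 q x y) (hp : p.Prime) {m : ℕ}
    (hspecial : ∀ j ≤ m, twoStepCentralizer 𝒜 ((j + 2) * q) = twoStepCentralizer 𝒜 (2 * q))
    (hlast : ∀ s, 0 < s → s < 2 * q →
      twoStepCentralizer 𝒜 ((m + 2) * q + s) = twoStepCentralizer 𝒜 2) :
    ∃ s, m + 3 = 2 * p ^ s := by
  obtain ⟨e, he⟩ := h.exists_eq_prime_pow hp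
  have hq2 := h.two_le
  have hC : ∀ s < q, twoStepCentralizer 𝒜 ((m + 1 + 2) * q + s) = twoStepCentralizer 𝒜 2 := by
    intro s hs
    rw [show (m + 1 + 2) * q + s = (m + 2) * q + (q + s) by ring]
    exact hlast _ (by omega) (by omega)
  have hz : deflationSeq F q x y (m + 1) ≠ 0 :=
    h.deflationSeq_ne_zero hp fun j hj => hspecial j (by omega)
  have hE : ∀ u, derivationPrimePow (ad F L x) hp e u = (ad F L x)^[q] u := fun u => by
    rw [derivationPrimePow_apply, he]
  set w := (ad F L x)^[q] (deflationSeq F q x y (m + 1))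
  have hw : w ∈ 𝒜 ((m + 1 + 2) * q + q) := h.iterate_mem (h.deflationSeq_mem _) q
  have hw0 : w ≠ 0 := h.iterate_ne_zero (h.two_le_add_two_mul _) (h.deflationSeq_mem _) hz hC
  refine exists_add_three_eq_two_mul_prime_pow_of_derivation hp
    (E := derivationPrimePow (ad F L x) hp e) (v := deflationElt F q x y) (w := w)
    (fun k hk => ?_) ?_ ?_ (h.ad_ne_zero (by omega) hw hw0) fun k hk => ?_
  · rw [hE, hE]
    exact h.iterate_deflationSeq_eq_zero (hspecial k hk)
  · rw [hE]
    exact h.deflationSeq_succ_eq_zero hC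
  · rw [hE, hE, ← deflationSeq]
  · have hmem := iterate_ad_mem hw h.deflationElt_mem k
    rw [hE, Function.iterate_succ_apply', LieDerivation.ad_apply_apply, or_comm]
    refine (h.iterate_ne_zero_or_lie_ne_zero hp he (by omega) hmem (ne_zero_of_map hk)).imp ?_ ?_
    · exact h.ad_ne_zero (by omega) (h.iterate_mem hmem q)
    · intro hlie
      refine h.ad_ne_zero (by omega)
        (SetLike.GradedBracket.bracket_mem h.deflationElt_mem hmem) ?_
      rwa [← lie_skew, neg_ne_zero]

end IsStandardPair

end Deflation

section Constituents

variable {F L : Type*} [Field F] [LieRing L] [LieAlgebra F L] {𝒜 : ℕ → Submodule F L}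

lemma ConstituentsFrom.of_append {i : ℕ} {l₁ l₂ : List ℕ} (h : ConstituentsFrom 𝒜 i (l₁ ++ l₂)) :
    ConstituentsFrom 𝒜 (i + l₁.sum) l₂ := by
  induction l₁ generalizing i with
  | nil => exact h
  | cons n l ih => simpa only [List.sum_cons, add_assoc] using ih h.2

lemma ConstituentsFrom.isConstituent_last {i m a b : ℕ}
    (h : ConstituentsFrom 𝒜 i (List.replicate m a ++ [b])) : IsConstituent 𝒜 (i + m * a) b := by
  simpa using h.of_append.1

lemma ConstituentsFrom.twoStepCentralizer_ne {i m a b j : ℕ}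
    (h : ConstituentsFrom 𝒜 i (List.replicate m a ++ [b])) (hj : j ≤ m) :
    twoStepCentralizer 𝒜 (i + j * a) ≠ twoStepCentralizer 𝒜 2 := by
  obtain ⟨k, rfl⟩ := Nat.exists_eq_add_of_le hj
  rw [← List.replicate_append_replicate, List.append_assoc] at h
  have h' : ConstituentsFrom 𝒜 (i + j * a) (List.replicate k a ++ [b]) := by
    simpa using h.of_append
  cases k with
  | zero => exact h'.1.2.2.1
  | succ k => exact h'.1.2.2.1

end Constituents

end MaxClass

theorem mainTheorem10_general {p : ℕ} (hp : p.Prime)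
    {F L : Type*} [Field F] [CharP F p] [LieRing L] [LieAlgebra F L]
    (𝒜 : ℕ → Submodule F L) [GradedLieAlgebra 𝒜] (hL : MaxClass.IsMaximalClass 𝒜)
    (hinf : ¬ FiniteDimensional F L)
    (q m : ℕ) (hq : MaxClass.IsParameter 𝒜 q)
    (hlen : MaxClass.InitialConstituentLengths 𝒜 (2 * q :: (List.replicate m q ++ [2 * q])))
    (htwo : MaxClass.InvolvesOnlyFirstTwo 𝒜 q
      (2 * q :: (List.replicate m q ++ [2 * q])).sum) :
    ∃ k : ℕ, (m : ℤ) = 2 * (p : ℤ) ^ k - 3 := by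
  obtain ⟨x, y, h⟩ := hL.exists_isStandardPair hinf hq
  have hspecial : ∀ j ≤ m, MaxClass.twoStepCentralizer 𝒜 ((j + 2) * q) =
      MaxClass.twoStepCentralizer 𝒜 (2 * q) := fun j hj => by
    refine (htwo _ (h.two_le_add_two_mul j) ?_).resolve_left ?_
    · simp only [List.sum_cons, List.sum_append, List.sum_replicate, smul_eq_mul, List.sum_nil]
      nlinarith
    · rw [add_comm j, add_mul]
      exact hlen.2.twoStepCentralizer_ne hj
  have hlast : ∀ s, 0 < s → s < 2 * q → MaxClass.twoStepCentralizer 𝒜 ((m + 2) * q + s) =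
      MaxClass.twoStepCentralizer 𝒜 2 := fun s hs0 hs => by
    rw [add_comm m, add_mul]
    exact hlen.2.isConstituent_last.2.2.2.2 s hs0 hs
  obtain ⟨k, hk⟩ := h.exists_add_three_eq_two_mul_prime_pow hp hspecial hlast
  exact ⟨k, eq_sub_of_add_eq (by exact_mod_cast hk)⟩

theorem mainTheorem10 {p : ℕ} (hp : p.Prime) (hp2 : p ≠ 2)
    {F L : Type*} [Field F] [CharP F p] [LieRing L] [LieAlgebra F L]
    (𝒜 : ℕ → Submodule F L) [GradedLieAlgebra 𝒜] (hL : MaxClass.IsMaximalClass 𝒜)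
    (hinf : ¬ FiniteDimensional F L)
    (q m : ℕ) (hq : MaxClass.IsParameter 𝒜 q)
    (hlen : MaxClass.InitialConstituentLengths 𝒜 (2 * q :: (List.replicate m q ++ [2 * q])))
    (htwo : MaxClass.InvolvesOnlyFirstTwo 𝒜 q
      (2 * q :: (List.replicate m q ++ [2 * q])).sum) :
    ∃ k : ℕ, (m : ℤ) = 2 * (p : ℤ) ^ k - 3 :=
  mainTheorem10_general hp 𝒜 hL hinf q m hq hlen htwo
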